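/- Let $\mathscr A$ be a complex ${}^*$-algebra, not necessarily unital. A linear functional $f:\mathscr A\to\mathbb C$ is *representable* if there are a ${}^*$-representation $\pi$ of $\mathscr A$ by bounded operators on a Hilbert space $H$ and a vector $\zeta\in H$ with $f(a)=(\pi(a)\zeta\mid\zeta)$ for all $a\in\mathscr A$; let $\mathscr A^\sharp$ be the set of representable functionals, ordered by $f\le g$ iff $(g-f)(a^*a)\ge 0$ for all $a\in\mathscr A$. For functionals $f,g$ write $f\ll g$ ($f$ is $g$-absolutely continuous) if for every sequence $(a_n)$ in $\mathscr A$ the conditions $g(a_n^*a_n)\to0$ and $f((a_n-a_m)^*(a_n-a_m))\to0$ (as $n,m\to\infty$) imply $f(a_n^*a_n)\to0$; write $f\perp g$ ($f$ and $g$ are singular) if $h=0$ is the only $h\in\mathscr A^\sharp$ with $h\le f$ and $h\le g$. For $f,g\in\mathscr A^\sharp$ with GNS triples $(H_f,\pi_f,\zeta_f)$ and $(H_g,\pi_g,\zeta_g)$ put $\pi=\pi_f\oplus\pi_g$ and let $P$ be the orthogonal projection of $H_f\oplus H_g$ onto the orthogonal complement of the closure of $\{\pi_f(a)\zeta_f\oplus\pi_g(a)\zeta_g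 : a\in\mathscr A\}$; the *parallel sum* $f:g\in\mathscr A^\sharp$ is $$(f:g)(a)=\bigl(\pi(a)P(\zeta_f\oplus0)\mid P(\zeta_f\oplus0)\bigr),\qquad a\in\mathscr A.$$ **Theorem.** Let $f,g\in\mathscr A^\sharp$. The least upper bound $[g]f:=\sup_{n\in\mathbb N} f:(ng)$ exists in the ordered set $\mathscr A^\sharp$, and $f=[g]f+(f-[g]f)$ is a $g$-Lebesgue decomposition of $f$; that is, $[g]f$ and $f-[g]f$ are representable, $[g]f\ll g$, and $(f-[g]f)\perp g$. Moreover $[g]f$ is maximal: every $h\in\mathscr A^\sharp$ with $h\le f$ and $h\ll g$ satisfies $h\le[g]f$. -/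

import Mathlib

open scoped ComplexOrder InnerProductSpace
open Filter Topology

universe u

/-! ### Functionals on a (not necessarily unital) complex ⋆-algebra -/

section Functionals

variable {A : Type u} [NonUnitalRing A] [StarRing A] [Module ℂ A] [StarModule ℂ A]
  [IsScalarTower ℂ A A] [SMulCommClass ℂ A A]

/-- A linear functional is positive if `f (a⋆ a) ≥ 0` for all `a` (in the order of `ℂ`, so the
value is real and nonnegative). -/
def IsPositiveFunctional (f : A →ₗ[ℂ] ℂ) : Prop :=
  ∀ a : A, 0 ≤ f (star a * a)

/-- `f` is representable if `f a = (π(a) ζ | ζ)` for a ⋆-representation `π` of `A` by bounded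
operators on some Hilbert space and a vector `ζ`. (Mathlib's inner product is linear in the second
argument. The functional is already represented on the closed linear span of the vectors `π(a) ζ`,
which is a completion of a quotient of `A`; so taking the Hilbert space in the universe of `A` is
no restriction.) -/
def IsRepresentable (f : A →ₗ[ℂ] ℂ) : Prop :=
  ∃ (H : Type u) (_ : NormedAddCommGroup H) (_ : InnerProductSpace ℂ H) (_ : CompleteSpace H)
    (π : A →⋆ₙₐ[ℂ] (H →L[ℂ] H)) (ζ : H), ∀ a : A, f a = ⟪ζ, π a ζ⟫_ℂ

/-- `f` is `g`-absolutely continuous: for every sequence `(aₙ)`, `g (aₙ⋆ aₙ) → 0` and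
`f ((aₙ - aₘ)⋆ (aₙ - aₘ)) → 0` as `n, m → ∞` imply `f (aₙ⋆ aₙ) → 0`. -/
def IsAbsolutelyContinuous (f g : A →ₗ[ℂ] ℂ) : Prop :=
  ∀ a : ℕ → A,
    Tendsto (fun n => g (star (a n) * a n)) atTop (𝓝 0) →
    Tendsto (fun p : ℕ × ℕ => f (star (a p.1 - a p.2) * (a p.1 - a p.2))) atTop (𝓝 0) →
    Tendsto (fun n => f (star (a n) * a n)) atTop (𝓝 0)

/-- `f` and `g` are singular: the only representable functional `h` with `h ≤ f` and `h ≤ g`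
is `0`; here `h ≤ f` means that `f - h` is positive. -/
def IsSingular (f g : A →ₗ[ℂ] ℂ) : Prop :=
  ∀ h : A →ₗ[ℂ] ℂ, IsRepresentable h →
    IsPositiveFunctional (f - h) → IsPositiveFunctional (g - h) → h = 0

/-- `f = f₁ + f₂` is a `g`-Lebesgue decomposition of `f`. -/
def IsLebesgueDecomposition (g f f₁ f₂ : A →ₗ[ℂ] ℂ) : Prop :=
  f = f₁ + f₂ ∧ IsRepresentable f₁ ∧ IsRepresentable f₂ ∧
    IsAbsolutelyContinuous f₁ g ∧ IsSingular f₂ g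

end Functionals

/-- The set of all representable functionals on `A`. -/
@[ext]
structure RepFunctional (A : Type u) [NonUnitalRing A] [StarRing A] [Module ℂ A] where
  /-- the underlying linear functional -/
  toLin : A →ₗ[ℂ] ℂ
  representable : IsRepresentable toLin

namespace RepFunctional

noncomputable section

variable {A : Type u} [NonUnitalRing A] [StarRing A] [Module ℂ A]

lemma star_mul_nonneg (f : RepFunctional A) (a : A) : 0 ≤ f.toLin (star a * a) := by
  obtain ⟨H, _, _, _, π, ζ, h⟩ := f.representable
  have : f.toLin (star a * a) = ⟪π a ζ, π a ζ⟫_ℂ := by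
    rw [h, map_mul, map_star, ContinuousLinearMap.star_eq_adjoint,
      mul_apply_eq_comp, ContinuousLinearMap.adjoint_inner_right]
  rw [this, inner_self_eq_norm_sq_to_K]
  simp

lemma conj_star_mul (f : RepFunctional A) (a b : A) :
    (starRingEnd ℂ) (f.toLin (star b * a)) = f.toLin (star a * b) := by
  obtain ⟨H, _, _, _, π, ζ, h⟩ := f.representable
  have (a b : A) : f.toLin (star a * b) = ⟪π a ζ, π b ζ⟫_ℂ := by
    rw [h, map_mul, map_star, ContinuousLinearMap.star_eq_adjoint,
      mul_apply_eq_comp, ContinuousLinearMap.adjoint_inner_right]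
  rw [this, this, inner_conj_symm]

/-- the Hilbert bound of `f` is finite -/
lemma exists_hilbert_bound (f : RepFunctional A) :
    ∃ M : ℝ, 0 ≤ M ∧ ∀ a : A, ‖f.toLin a‖ ≤ M * √(f.toLin (star a * a)).re := by
  obtain ⟨H, _, _, _, π, ζ, h⟩ := f.representable
  refine ⟨‖ζ‖, norm_nonneg _, fun a => ?_⟩
  have : f.toLin (star a * a) = ⟪π a ζ, π a ζ⟫_ℂ := by
    rw [h, map_mul, map_star, ContinuousLinearMap.star_eq_adjoint,
      mul_apply_eq_comp, ContinuousLinearMap.adjoint_inner_right]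
  rw [this, h]
  have h2 : √(⟪π a ζ, π a ζ⟫_ℂ).re = ‖π a ζ‖ := by
    rw [norm_eq_sqrt_re_inner (𝕜 := ℂ)]; rfl
  rw [h2]
  exact norm_inner_le_norm _ _

/-- left multiplications are bounded for the seminorm of `f` -/
lemma exists_left_bound (f : RepFunctional A) (b : A) :
    ∃ M : ℝ, ∀ a : A,
      √(f.toLin (star (b * a) * (b * a))).re ≤ M * √(f.toLin (star a * a)).re := by
  obtain ⟨H, _, _, _, π, ζ, h⟩ := f.representable
  have key (a : A) : √(f.toLin (star a * a)).re = ‖π a ζ‖ := by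
    rw [h, map_mul, map_star, ContinuousLinearMap.star_eq_adjoint,
      mul_apply_eq_comp, ContinuousLinearMap.adjoint_inner_right,
      norm_eq_sqrt_re_inner (𝕜 := ℂ)]
    rfl
  refine ⟨‖π b‖, fun a => ?_⟩
  rw [key, key, map_mul, mul_apply_eq_comp]
  exact (π b).le_opNorm _

/-! ### The GNS triple of a representable functional -/

set_option linter.unusedVariables false in
/-- The space `A` with the semi-inner product `(a | b) = f (b⋆ a)`. -/
@[nolint unusedArguments]
def PreGNS (f : RepFunctional A) : Type u := A

instance (f : RepFunctional A) : AddCommGroup f.PreGNS := inferInstanceAs (AddCommGroup A)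
instance (f : RepFunctional A) : Module ℂ f.PreGNS := inferInstanceAs (Module ℂ A)

/-- the identity map `A → PreGNS f` -/
def toPreGNS (f : RepFunctional A) : A ≃ₗ[ℂ] f.PreGNS := LinearEquiv.refl ℂ _

/-- the identity map `PreGNS f → A` -/
def ofPreGNS (f : RepFunctional A) : f.PreGNS ≃ₗ[ℂ] A := f.toPreGNS.symm

@[simp] lemma ofPreGNS_toPreGNS (f : RepFunctional A) (a : A) :
    f.ofPreGNS (f.toPreGNS a) = a := rfl

variable [StarModule ℂ A] [IsScalarTower ℂ A A] [SMulCommClass ℂ A A]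

/-- the semi-inner product of `f` -/
abbrev preCore (f : RepFunctional A) : PreInnerProductSpace.Core ℂ f.PreGNS where
  inner a b := f.toLin (star (f.ofPreGNS a) * f.ofPreGNS b)
  conj_inner_symm a b := f.conj_star_mul _ _
  re_inner_nonneg a := (RCLike.nonneg_iff.mp (f.star_mul_nonneg (f.ofPreGNS a))).1
  add_left _ _ _ := by rw [map_add, star_add, add_mul, map_add]
  smul_left := by simp [smul_mul_assoc]

instance (f : RepFunctional A) : SeminormedAddCommGroup f.PreGNS :=
  InnerProductSpace.Core.toSeminormedAddCommGroup (c := f.preCore)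

instance (f : RepFunctional A) : InnerProductSpace ℂ f.PreGNS :=
  InnerProductSpace.ofCore f.preCore

set_option linter.unusedSectionVars false in
lemma preGNS_inner_def (f : RepFunctional A) (a b : f.PreGNS) :
    ⟪a, b⟫_ℂ = f.toLin (star (f.ofPreGNS a) * f.ofPreGNS b) := rfl

/-- The GNS Hilbert space `H_f`: the (Hausdorff) completion of `A` for `(a | b) = f (b⋆ a)`. -/
abbrev GNS (f : RepFunctional A) : Type u := UniformSpace.Completion f.PreGNS

/-- left multiplication by `a` on the pre-GNS space -/
def leftMul (f : RepFunctional A) (a : A) : f.PreGNS →L[ℂ] f.PreGNS :=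
  LinearMap.mkContinuousOfExistsBound
    (f.toPreGNS.toLinearMap ∘ₗ LinearMap.mulLeft ℂ a ∘ₗ f.ofPreGNS.toLinearMap)
    (by
      obtain ⟨M, hM⟩ := f.exists_left_bound a
      exact ⟨M, fun x => hM (f.ofPreGNS x)⟩)

@[simp] lemma leftMul_apply (f : RepFunctional A) (a : A) (x : f.PreGNS) :
    f.leftMul a x = f.toPreGNS (a * f.ofPreGNS x) := rfl

open UniformSpace.Completion in
lemma leftMul_completion_smul (f : RepFunctional A) (c : ℂ) (a : A) :
    (f.leftMul (c • a)).completion = c • (f.leftMul a).completion := by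
  ext x
  induction x using induction_on with
  | hp =>
    exact isClosed_eq (f.leftMul (c • a)).completion.continuous
      (c • (f.leftMul a).completion).continuous
  | ih x => simp [smul_mul_assoc]

open UniformSpace.Completion in
/-- The GNS representation `π_f`: the continuous extension of left multiplication. -/
def gnsRep (f : RepFunctional A) : A →⋆ₙₐ[ℂ] (f.GNS →L[ℂ] f.GNS) where
  toFun a := (f.leftMul a).completion
  map_smul' := fun c a => f.leftMul_completion_smul c a
  map_zero' := by simpa using f.leftMul_completion_smul 0 0
  map_add' _ _ := by
    ext c
    induction c using induction_on with
    | hp => apply isClosed_eq <;> fun_prop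
    | ih c => simp [add_mul, UniformSpace.Completion.coe_add]
  map_mul' _ _ := by
    ext c
    induction c using induction_on with
    | hp => apply isClosed_eq <;> fun_prop
    | ih c => simp [mul_assoc]
  map_star' a := by
    refine (ContinuousLinearMap.eq_adjoint_iff (f.leftMul (star a)).completion
      (f.leftMul a).completion).mpr ?_
    intro x y
    induction x, y using induction_on₂ with
    | hp => apply isClosed_eq <;> fun_prop
    | ih x y => simp [mul_assoc, preGNS_inner_def]

@[simp] lemma gnsRep_coe (f : RepFunctional A) (a : A) (x : f.PreGNS) :
    f.gnsRep a (x : f.GNS) = ((f.toPreGNS (a * f.ofPreGNS x) : f.PreGNS) : f.GNS) := by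
  change (f.leftMul a).completion x = _
  simp

/-- `f` as a bounded functional on the pre-GNS space -/
def preFunctional (f : RepFunctional A) : f.PreGNS →L[ℂ] ℂ :=
  LinearMap.mkContinuousOfExistsBound (f.toLin ∘ₗ f.ofPreGNS.toLinearMap)
    (by
      obtain ⟨M, -, hM⟩ := f.exists_hilbert_bound
      exact ⟨M, fun x => hM (f.ofPreGNS x)⟩)

/-- The cyclic vector `ζ_f`: the Riesz representing vector of the continuous extension of `f`
to `H_f`. -/
def gnsVec (f : RepFunctional A) : f.GNS :=
  (InnerProductSpace.toDual ℂ f.GNS).symm f.preFunctional.fromCompletion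

set_option linter.unusedSectionVars false in
lemma inner_gnsVec_coe (f : RepFunctional A) (a : A) :
    ⟪f.gnsVec, ((f.toPreGNS a : f.PreGNS) : f.GNS)⟫_ℂ = f.toLin a := by
  rw [gnsVec, InnerProductSpace.toDual_symm_apply]
  simp [preFunctional]

open UniformSpace.Completion in
/-- `π_f(a) ζ_f` is the class of `a`; in particular `ζ_f` is cyclic. -/
lemma gnsRep_gnsVec (f : RepFunctional A) (a : A) :
    f.gnsRep a f.gnsVec = ((f.toPreGNS a : f.PreGNS) : f.GNS) := by
  refine ext_inner_right ℂ fun y => ?_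
  induction y using induction_on with
  | hp => apply isClosed_eq <;> fun_prop
  | ih y =>
    rw [← ContinuousLinearMap.adjoint_inner_right, ← ContinuousLinearMap.star_eq_adjoint,
      ← map_star, gnsRep_coe, inner_gnsVec_coe, UniformSpace.Completion.inner_coe,
      preGNS_inner_def, ofPreGNS_toPreGNS]

/-- The GNS triple represents `f`. -/
lemma inner_gnsVec (f : RepFunctional A) (a : A) :
    ⟪f.gnsVec, f.gnsRep a f.gnsVec⟫_ℂ = f.toLin a := by
  rw [gnsRep_gnsVec, inner_gnsVec_coe]

/-! ### Order and multiples -/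

lemma apply_star_mul_eq_zero {d : A →ₗ[ℂ] ℂ} (hd : ∀ a : A, d (star a * a) = 0)
    (a b : A) : d (star a * b) = 0 := by
  have h1 := hd (a + b)
  have h2 := hd (a + Complex.I • b)
  simp only [star_add, star_smul, mul_add, add_mul, smul_mul_assoc, mul_smul_comm, map_add,
    map_smul, hd, smul_eq_mul, Complex.star_def, Complex.conj_I] at h1 h2
  have h3 : d (star b * a) = - d (star a * b) := by linear_combination h1
  rw [h3] at h2
  have h4 : (2 * Complex.I) * d (star a * b) = 0 := by linear_combination h2
  simpa using h4

open UniformSpace.Completion in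
/-- Representable functionals that agree on all `a⋆ a` are equal. -/
lemma ext_star_mul {f g : RepFunctional A}
    (h : ∀ a : A, f.toLin (star a * a) = g.toLin (star a * a)) : f = g := by
  have hd (a b : A) : (g.toLin - f.toLin) (star a * b) = 0 :=
    apply_star_mul_eq_zero (fun a => by simp [h a]) a b
  let φ : f.PreGNS →L[ℂ] ℂ :=
    LinearMap.mkContinuousOfExistsBound ((g.toLin - f.toLin) ∘ₗ f.ofPreGNS.toLinearMap) (by
      obtain ⟨M, -, hM⟩ := f.exists_hilbert_bound
      obtain ⟨N, -, hN⟩ := g.exists_hilbert_bound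
      refine ⟨N + M, fun x => ?_⟩
      have h1 := hM (f.ofPreGNS x)
      have h2 := hN (f.ofPreGNS x)
      rw [← h] at h2
      change ‖g.toLin (f.ofPreGNS x) - f.toLin (f.ofPreGNS x)‖ ≤
        (N + M) * √(f.toLin (star (f.ofPreGNS x) * f.ofPreGNS x)).re
      rw [add_mul]
      exact (norm_sub_le _ _).trans (add_le_add h2 h1))
  let η : f.GNS := (InnerProductSpace.toDual ℂ f.GNS).symm φ.fromCompletion
  have hη (x : f.PreGNS) : ⟪η, (x : f.GNS)⟫_ℂ = (g.toLin - f.toLin) (f.ofPreGNS x) := by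
    change ⟪(InnerProductSpace.toDual ℂ f.GNS).symm φ.fromCompletion, (x : f.GNS)⟫_ℂ = _
    rw [InnerProductSpace.toDual_symm_apply]
    simp [φ]
  have hπ (b : A) : f.gnsRep b η = 0 := by
    refine ext_inner_right ℂ fun y => ?_
    induction y using induction_on with
    | hp => apply isClosed_eq <;> fun_prop
    | ih y =>
      rw [← ContinuousLinearMap.adjoint_inner_right, ← ContinuousLinearMap.star_eq_adjoint,
        ← map_star, gnsRep_coe, hη, inner_zero_left]
      exact hd _ _
  have h0 (a : A) : (g.toLin - f.toLin) a = 0 := by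
    have h1 := hη (f.toPreGNS a)
    rw [← gnsRep_gnsVec, ← ContinuousLinearMap.adjoint_inner_left,
      ← ContinuousLinearMap.star_eq_adjoint, ← map_star, hπ, inner_zero_left] at h1
    exact h1.symm
  apply RepFunctional.ext
  ext a
  exact (sub_eq_zero.mp (h0 a)).symm

/-- The order on representable functionals: `f ≤ g` means that `g - f` is positive. -/
instance : PartialOrder (RepFunctional A) where
  le f g := IsPositiveFunctional (g.toLin - f.toLin)
  le_refl f a := by simp
  le_trans f g h hfg hgh a := by
    have h1 := add_nonneg (hgh a) (hfg a)
    simpa using h1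
  le_antisymm f g hfg hgf := ext_star_mul fun a => by
    have h1 := hfg a
    have h2 := hgf a
    simp only [LinearMap.sub_apply, sub_nonneg] at h1 h2
    exact le_antisymm h1 h2

/-- The multiples `n g`. -/
instance : SMul ℕ (RepFunctional A) where
  smul n g :=
    { toLin := n • g.toLin
      representable := by
        obtain ⟨H, i1, i2, i3, π, ζ, h⟩ := g.representable
        refine ⟨H, i1, i2, i3, π, ((√(n : ℝ) : ℝ) : ℂ) • ζ, fun a => ?_⟩
        rw [map_smul, inner_smul_left, inner_smul_right, ← mul_assoc, Complex.conj_ofReal,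
          ← Complex.ofReal_mul, Real.mul_self_sqrt (Nat.cast_nonneg n), ← h]
        simp }

/-! ### The parallel sum -/

/-- The direct sum of two bounded operators, on the Hilbert space direct sum. -/
def directSumOp {H K : Type u} [NormedAddCommGroup H] [InnerProductSpace ℂ H]
    [NormedAddCommGroup K] [InnerProductSpace ℂ K] (S : H →L[ℂ] H) (T : K →L[ℂ] K) :
    WithLp 2 (H × K) →L[ℂ] WithLp 2 (H × K) :=
  (WithLp.prodContinuousLinearEquiv 2 ℂ H K).symm.toContinuousLinearMap ∘L
    (S.prodMap T) ∘L (WithLp.prodContinuousLinearEquiv 2 ℂ H K).toContinuousLinearMap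

@[simp] lemma directSumOp_apply {H K : Type u} [NormedAddCommGroup H] [InnerProductSpace ℂ H]
    [NormedAddCommGroup K] [InnerProductSpace ℂ K] (S : H →L[ℂ] H) (T : K →L[ℂ] K)
    (x : WithLp 2 (H × K)) :
    directSumOp S T x = WithLp.toLp 2 (S x.fst, T x.snd) := rfl

/-- The direct sum of two ⋆-representations. -/
def directSumRep {H K : Type u} [NormedAddCommGroup H] [InnerProductSpace ℂ H] [CompleteSpace H]
    [NormedAddCommGroup K] [InnerProductSpace ℂ K] [CompleteSpace K]
    (π : A →⋆ₙₐ[ℂ] (H →L[ℂ] H)) (ρ : A →⋆ₙₐ[ℂ] (K →L[ℂ] K)) :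
    A →⋆ₙₐ[ℂ] (WithLp 2 (H × K) →L[ℂ] WithLp 2 (H × K)) where
  toFun a := directSumOp (π a) (ρ a)
  map_smul' c a := by ext x; simp; rfl
  map_zero' := by ext x; simp
  map_add' a b := by ext x; simp; rfl
  map_mul' a b := by ext x; simp
  map_star' a := by
    refine (ContinuousLinearMap.eq_adjoint_iff _ _).mpr fun x y => ?_
    simp [map_star, ContinuousLinearMap.star_eq_adjoint,
      ContinuousLinearMap.adjoint_inner_left]

/-- The subspace `{π_f(a) ζ_f ⊕ π_g(a) ζ_g | a ∈ A}` of `H_f ⊕ H_g`. -/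
def diagonal (f g : RepFunctional A) : Submodule ℂ (WithLp 2 (f.GNS × g.GNS)) :=
  LinearMap.range
    ({ toFun := fun a => WithLp.toLp 2 (f.gnsRep a f.gnsVec, g.gnsRep a g.gnsVec)
       map_add' := fun a b => by simp; rfl
       map_smul' := fun c a => by simp; rfl } : A →ₗ[ℂ] WithLp 2 (f.GNS × g.GNS))

/-- The vector `P (ζ_f ⊕ 0)`, where `P` is the orthogonal projection of `H_f ⊕ H_g` onto the
orthogonal complement of (the closure of) `{π_f(a) ζ_f ⊕ π_g(a) ζ_g | a ∈ A}`. -/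
def parallelVec (f g : RepFunctional A) : WithLp 2 (f.GNS × g.GNS) :=
  ((diagonal f g).topologicalClosureᗮ).starProjection (WithLp.toLp 2 (f.gnsVec, 0))

/-- The functional `a ↦ (π(a) ζ | ζ)` of a ⋆-representation and a vector. -/
def ofVector {H : Type u} [NormedAddCommGroup H] [InnerProductSpace ℂ H] [CompleteSpace H]
    (π : A →⋆ₙₐ[ℂ] (H →L[ℂ] H)) (ζ : H) : RepFunctional A where
  toLin :=
    { toFun := fun a => ⟪ζ, π a ζ⟫_ℂ
      map_add' := fun a b => by simp
      map_smul' := fun c a => by simp }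
  representable := ⟨H, inferInstance, inferInstance, inferInstance, π, ζ, fun _ => rfl⟩

/-- The parallel sum `f : g`, i.e. `(f : g)(a) = (π(a) P(ζ_f ⊕ 0) | P(ζ_f ⊕ 0))` with
`π = π_f ⊕ π_g`. -/
def parallelSum (f g : RepFunctional A) : RepFunctional A :=
  ofVector (directSumRep f.gnsRep g.gnsRep) (parallelVec f g)

end

end RepFunctional

/-! Write [a]_f for the class of `a` in H_f. The closure of all [a]_f ⊕ [a]_g is invariant under π_f
⊕ π_g. Hence M, the set of limits of sequences [b_n]_f with [b_n]_g → 0, is a closed subspace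
reducing π_f. Splitting ζ_f along M and its complement splits f into `singPart` and `acPart`, with
squared seminorms ‖P_M [a]_f‖² and ‖[a]_f - P_M [a]_f‖² = dist([a]_f, M)².

Order and absolute continuity depend only on these seminorms. A functional h ≤ f with h ≪ g must
ignore the M-component, so h ≤ `acPart`. A common minorant of `singPart` and g is small on a - b_n
and on b_n when [b_n]_f → P_M [a]_f is g-null, so it vanishes.

For the supremum, (f : ng)(a⋆a) is the infimum over b of ‖[a - b]_f‖² + n‖[b]_g‖². As n grows, the
penalty forces near-minimisers to be g-null; the parallelogram law makes their f-classes converge,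
to a point of M. So the infima have supremum dist([a]_f, M)². -/

namespace RepFunctional

noncomputable section

/-! ### Reducing subspaces and GNS seminorms -/

/-- The orthogonal projection onto a reducing subspace of `T` commutes with `T`. -/
lemma starProjection_comm_of_reducing {H : Type*} [NormedAddCommGroup H]
    [InnerProductSpace ℂ H] [CompleteSpace H] (U : Submodule ℂ H) [U.HasOrthogonalProjection]
    (T : H →L[ℂ] H) (hT : ∀ x ∈ U, T x ∈ U) (hT' : ∀ x ∈ U, star T x ∈ U) (x : H) :
    T (U.starProjection x) = U.starProjection (T x) := by
  refine (Submodule.eq_starProjection_of_mem_of_inner_eq_zero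
    (hT _ (U.starProjection_apply_mem x)) fun w hw => ?_).symm
  rw [← map_sub, ← ContinuousLinearMap.adjoint_inner_right]
  exact (Submodule.mem_orthogonal' _ _).mp (U.sub_starProjection_mem_orthogonal x) _ (hT' w hw)

lemma inner_map_star_mul {A : Type*} [NonUnitalRing A] [StarRing A] [Module ℂ A]
    {H : Type*} [NormedAddCommGroup H] [InnerProductSpace ℂ H] [CompleteSpace H]
    (π : A →⋆ₙₐ[ℂ] (H →L[ℂ] H)) (ζ : H) (a : A) :
    ⟪ζ, π (star a * a) ζ⟫_ℂ = ((‖π a ζ‖ ^ 2 : ℝ) : ℂ) := by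
  rw [map_mul, map_star, ContinuousLinearMap.star_eq_adjoint,
    mul_apply_eq_comp, ContinuousLinearMap.adjoint_inner_right, inner_self_eq_norm_sq_to_K]
  simp

variable {A : Type u} [NonUnitalRing A] [StarRing A] [Module ℂ A] [StarModule ℂ A]
  [IsScalarTower ℂ A A] [SMulCommClass ℂ A A]

/-- The class of `a` in the GNS space. -/
def gnsClass (f : RepFunctional A) : A →ₗ[ℂ] f.GNS where
  toFun a := f.gnsRep a f.gnsVec
  map_add' a b := by simp
  map_smul' c a := by simp

lemma gnsRep_gnsClass (f : RepFunctional A) (a b : A) :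
    f.gnsRep a (f.gnsClass b) = f.gnsClass (a * b) := by
  simp [gnsClass]

lemma toLin_star_mul (f : RepFunctional A) (a : A) :
    f.toLin (star a * a) = ((‖f.gnsClass a‖ ^ 2 : ℝ) : ℂ) := by
  rw [← inner_gnsVec, inner_map_star_mul]; rfl

/-- Both sides are the square root of the functional at `star a * a`, so GNS norms can be computed
in any representing space. -/
lemma norm_gnsClass_ofVector {H : Type u} [NormedAddCommGroup H]
    [InnerProductSpace ℂ H] [CompleteSpace H] (π : A →⋆ₙₐ[ℂ] (H →L[ℂ] H)) (ζ : H) (a : A) :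
    ‖(ofVector π ζ).gnsClass a‖ = ‖π a ζ‖ := by
  have h : ((‖(ofVector π ζ).gnsClass a‖ ^ 2 : ℝ) : ℂ) = ((‖π a ζ‖ ^ 2 : ℝ) : ℂ) := by
    rw [← toLin_star_mul, ← inner_map_star_mul]; rfl
  exact (sq_eq_sq₀ (norm_nonneg _) (norm_nonneg _)).mp (Complex.ofReal_injective h)

lemma norm_gnsClass_nsmul_sq (g : RepFunctional A) (n : ℕ) (a : A) :
    ‖(n • g).gnsClass a‖ ^ 2 = n * ‖g.gnsClass a‖ ^ 2 := by
  have h : ((‖(n • g).gnsClass a‖ ^ 2 : ℝ) : ℂ) = ((n * ‖g.gnsClass a‖ ^ 2 : ℝ) : ℂ) := by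
    rw [← toLin_star_mul, Complex.ofReal_mul, ← toLin_star_mul]
    change (n • g.toLin) (star a * a) = _
    simp
  exact Complex.ofReal_injective h

lemma le_iff_norm_sq (f g : RepFunctional A) :
    f ≤ g ↔ ∀ a, ‖f.gnsClass a‖ ^ 2 ≤ ‖g.gnsClass a‖ ^ 2 := by
  refine forall_congr' fun a => ?_
  rw [LinearMap.sub_apply, toLin_star_mul, toLin_star_mul, sub_nonneg, Complex.real_le_real]

lemma le_iff_norm (f g : RepFunctional A) :
    f ≤ g ↔ ∀ a, ‖f.gnsClass a‖ ≤ ‖g.gnsClass a‖ := by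
  rw [le_iff_norm_sq]
  exact forall_congr' fun a => sq_le_sq₀ (norm_nonneg _) (norm_nonneg _)

lemma tendsto_toLin_star_mul_iff {ι : Type*} {l : Filter ι} (f : RepFunctional A) (a : ι → A) :
    Tendsto (fun i => f.toLin (star (a i) * a i)) l (𝓝 0) ↔
      Tendsto (fun i => ‖f.gnsClass (a i)‖) l (𝓝 0) := by
  rw [← Complex.ofReal_zero]
  simp only [toLin_star_mul]
  rw [Filter.tendsto_ofReal_iff]
  constructor
  · intro h
    simpa using h.sqrt
  · intro h
    simpa using h.pow 2

lemma isAbsolutelyContinuous_iff (f g : RepFunctional A) :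
    IsAbsolutelyContinuous f.toLin g.toLin ↔ ∀ a : ℕ → A,
      Tendsto (fun n => ‖g.gnsClass (a n)‖) atTop (𝓝 0) →
      CauchySeq (fun n => f.gnsClass (a n)) →
      Tendsto (fun n => ‖f.gnsClass (a n)‖) atTop (𝓝 0) := by
  refine forall_congr' fun a => ?_
  rw [tendsto_toLin_star_mul_iff, tendsto_toLin_star_mul_iff, tendsto_toLin_star_mul_iff,
    cauchySeq_iff_tendsto_dist_atTop_0]
  simp only [map_sub, dist_eq_norm]

/-! ### The infimum formula for the parallel sum -/

/-- The vector `[a]_f ⊕ [a]_g`. -/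
def diagonalVec (f g : RepFunctional A) (a : A) : WithLp 2 (f.GNS × g.GNS) :=
  WithLp.toLp 2 (f.gnsClass a, g.gnsClass a)

lemma mem_diagonal_iff (f g : RepFunctional A) (x : WithLp 2 (f.GNS × g.GNS)) :
    x ∈ diagonal f g ↔ ∃ a, diagonalVec f g a = x := Iff.rfl

lemma directSumRep_mem_topologicalClosure (f g : RepFunctional A) (a : A)
    {x : WithLp 2 (f.GNS × g.GNS)} (hx : x ∈ (diagonal f g).topologicalClosure) :
    directSumRep f.gnsRep g.gnsRep a x ∈ (diagonal f g).topologicalClosure := by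
  refine map_mem_closure (directSumRep f.gnsRep g.gnsRep a).continuous hx ?_
  rintro _ ⟨b, rfl⟩
  refine ⟨a * b, ?_⟩
  change diagonalVec f g (a * b) = directSumOp (f.gnsRep a) (g.gnsRep a) (diagonalVec f g b)
  simp [diagonalVec, gnsRep_gnsClass]

/-- The closed diagonal is invariant under a self-adjoint family of operators, so its complement is
too, and the projection commutes with the representation. -/
lemma directSumRep_parallelVec (f g : RepFunctional A) (a : A) :
    directSumRep f.gnsRep g.gnsRep a (parallelVec f g) =
      (diagonal f g).topologicalClosureᗮ.starProjection (WithLp.toLp 2 (f.gnsClass a, 0)) := by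
  have key (b : A) (x : WithLp 2 (f.GNS × g.GNS)) (hx : x ∈ (diagonal f g).topologicalClosureᗮ) :
      star (directSumRep f.gnsRep g.gnsRep b) x ∈ (diagonal f g).topologicalClosureᗮ := by
    refine (Submodule.mem_orthogonal _ _).mpr fun y hy => ?_
    rw [ContinuousLinearMap.star_eq_adjoint, ContinuousLinearMap.adjoint_inner_right]
    exact (Submodule.mem_orthogonal _ _).mp hx _ (directSumRep_mem_topologicalClosure f g b hy)
  rw [parallelVec, starProjection_comm_of_reducing _ _ _ (key a)]
  · congr 1
    change directSumOp (f.gnsRep a) (g.gnsRep a) _ = _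
    simp [gnsClass]
  · intro x hx
    have := key (star a) x hx
    rwa [← map_star, star_star] at this

lemma norm_sq_sub_diagonalVec (f g : RepFunctional A) (a b : A) :
    ‖WithLp.toLp 2 (f.gnsClass a, (0 : g.GNS)) - diagonalVec f g b‖ ^ 2 =
      ‖f.gnsClass a - f.gnsClass b‖ ^ 2 + ‖g.gnsClass b‖ ^ 2 := by
  rw [WithLp.prod_norm_sq_eq_of_L2]
  simp [diagonalVec]

/-- Upper half of the infimum formula: the projection kills diagonal vectors, so any of them may be
subtracted before it contracts. -/
lemma norm_parallelSum_sq_le (f g : RepFunctional A) (a b : A) :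
    ‖(parallelSum f g).gnsClass a‖ ^ 2 ≤
      ‖f.gnsClass a - f.gnsClass b‖ ^ 2 + ‖g.gnsClass b‖ ^ 2 := by
  rw [parallelSum, norm_gnsClass_ofVector, directSumRep_parallelVec, ← norm_sq_sub_diagonalVec]
  gcongr
  have h0 : (diagonal f g).topologicalClosureᗮ.starProjection (diagonalVec f g b) = 0 := by
    rw [Submodule.starProjection_apply_eq_zero_iff]
    exact Submodule.le_orthogonal_orthogonal _
      ((diagonal f g).le_topologicalClosure ((mem_diagonal_iff f g _).mpr ⟨b, rfl⟩))
  rw [← sub_zero ((diagonal f g).topologicalClosureᗮ.starProjection _), ← h0, ← map_sub]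
  exact Submodule.norm_starProjection_apply_le _ _

/-- Lower half of the infimum formula: the nearest point of the closure is a limit of diagonal
vectors. -/
lemma exists_lt_norm_parallelSum_sq_add (f g : RepFunctional A) (a : A) {ε : ℝ} (hε : 0 < ε) :
    ∃ b, ‖f.gnsClass a - f.gnsClass b‖ ^ 2 + ‖g.gnsClass b‖ ^ 2 <
      ‖(parallelSum f g).gnsClass a‖ ^ 2 + ε := by
  rw [parallelSum, norm_gnsClass_ofVector, directSumRep_parallelVec]
  set x : WithLp 2 (f.GNS × g.GNS) := WithLp.toLp 2 (f.gnsClass a, 0) with hx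
  set D := (diagonal f g).topologicalClosure with hD
  have hm : D.starProjection x ∈ closure (diagonal f g : Set (WithLp 2 (f.GNS × g.GNS))) :=
    D.starProjection_apply_mem x
  have hP : Dᗮ.starProjection x = x - D.starProjection x := by
    rw [Submodule.starProjection_orthogonal]
    rfl
  have hopen : IsOpen {y : WithLp 2 (f.GNS × g.GNS) |
      ‖x - y‖ ^ 2 < ‖Dᗮ.starProjection x‖ ^ 2 + ε} :=
    isOpen_lt (by fun_prop) continuous_const
  obtain ⟨y, hy, b, rfl⟩ := mem_closure_iff.mp hm _ hopen (by simp [hP, hε])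
  refine ⟨b, ?_⟩
  rw [← norm_sq_sub_diagonalVec]
  exact hy

/-! ### The multivalued part of the closure of the diagonal -/

/-- The embedding `x ↦ x ⊕ 0`. -/
def inlCLM (f g : RepFunctional A) : f.GNS →L[ℂ] WithLp 2 (f.GNS × g.GNS) :=
  (WithLp.prodContinuousLinearEquiv 2 ℂ f.GNS g.GNS).symm.toContinuousLinearMap ∘L
    ContinuousLinearMap.inl ℂ f.GNS g.GNS

/-- The vectors `x ∈ H_f` such that `x ⊕ 0` is in the closure of the diagonal. -/
def multivaluedPart (f g : RepFunctional A) : Submodule ℂ f.GNS :=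
  (diagonal f g).topologicalClosure.comap (inlCLM f g).toLinearMap

lemma mem_multivaluedPart (f g : RepFunctional A) (x : f.GNS) :
    x ∈ multivaluedPart f g ↔
      inlCLM f g x ∈ (diagonal f g).topologicalClosure := Iff.rfl

instance (f g : RepFunctional A) : CompleteSpace (multivaluedPart f g) :=
  ((diagonal f g).isClosed_topologicalClosure.preimage
    (inlCLM f g).continuous).completeSpace_coe

lemma mem_multivaluedPart_iff (f g : RepFunctional A) (x : f.GNS) :
    x ∈ multivaluedPart f g ↔ ∃ b : ℕ → A,
      Tendsto (fun n => f.gnsClass (b n)) atTop (𝓝 x) ∧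
      Tendsto (fun n => ‖g.gnsClass (b n)‖) atTop (𝓝 0) := by
  rw [mem_multivaluedPart]
  change _ ∈ closure _ ↔ _
  rw [mem_closure_iff_seq_limit]
  constructor
  · rintro ⟨y, hy, hyx⟩
    choose b hb using hy
    have h := (WithLp.prodContinuousLinearEquiv 2 ℂ f.GNS g.GNS).continuous.tendsto _ |>.comp hyx
    have h1 := (continuous_fst.tendsto _).comp h
    have h2 := (continuous_snd.tendsto _).comp h
    obtain rfl : y = fun n => diagonalVec f g (b n) := funext fun n => (hb n).symm
    exact ⟨b, h1, tendsto_zero_iff_norm_tendsto_zero.mp h2⟩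
  · rintro ⟨b, h1, h2⟩
    refine ⟨fun n => diagonalVec f g (b n), fun n => ⟨b n, rfl⟩, ?_⟩
    exact ((WithLp.prodContinuousLinearEquiv 2 ℂ f.GNS g.GNS).symm.continuous.tendsto _).comp
      (h1.prodMk_nhds (tendsto_zero_iff_norm_tendsto_zero.mpr h2))

lemma gnsRep_mem_multivaluedPart (f g : RepFunctional A) (a : A) {x : f.GNS}
    (hx : x ∈ multivaluedPart f g) : f.gnsRep a x ∈ multivaluedPart f g := by
  have h := directSumRep_mem_topologicalClosure f g a hx
  change directSumOp (f.gnsRep a) (g.gnsRep a) (WithLp.toLp 2 (x, 0)) ∈ _ at h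
  change WithLp.toLp 2 (f.gnsRep a x, (0 : g.GNS)) ∈ (diagonal f g).topologicalClosure
  simpa using h

/-! ### The two parts of f -/

/-- The component of `[a]_f` in the multivalued part. -/
abbrev singClass (f g : RepFunctional A) (a : A) : f.GNS :=
  (multivaluedPart f g).starProjection (f.gnsClass a)

lemma gnsRep_starProjection_gnsVec (f g : RepFunctional A) (a : A) :
    f.gnsRep a ((multivaluedPart f g).starProjection f.gnsVec) = singClass f g a :=
  starProjection_comm_of_reducing _ _ (fun _ hx => gnsRep_mem_multivaluedPart f g a hx)
    (fun x hx => by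
      rw [← map_star]
      exact gnsRep_mem_multivaluedPart f g (star a) hx) _

/-- The `g`-absolutely continuous part of `f`. -/
def acPart (f g : RepFunctional A) : RepFunctional A :=
  ofVector f.gnsRep (f.gnsVec - (multivaluedPart f g).starProjection f.gnsVec)

/-- The `g`-singular part of `f`. -/
def singPart (f g : RepFunctional A) : RepFunctional A :=
  ofVector f.gnsRep ((multivaluedPart f g).starProjection f.gnsVec)

lemma norm_acPart (f g : RepFunctional A) (a : A) :
    ‖(acPart f g).gnsClass a‖ = ‖f.gnsClass a - singClass f g a‖ := by
  rw [acPart, norm_gnsClass_ofVector, map_sub, gnsRep_starProjection_gnsVec]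
  rfl

lemma norm_singPart (f g : RepFunctional A) (a : A) :
    ‖(singPart f g).gnsClass a‖ = ‖singClass f g a‖ := by
  rw [singPart, norm_gnsClass_ofVector, gnsRep_starProjection_gnsVec]

/-- The cross terms vanish because π_f preserves both M and its complement. -/
lemma toLin_sub_acPart (f g : RepFunctional A) :
    f.toLin - (acPart f g).toLin = (singPart f g).toLin := by
  ext a
  set M := multivaluedPart f g
  set z := M.starProjection f.gnsVec with hz
  have hzM : z ∈ M := M.starProjection_apply_mem _
  have hs : f.gnsRep a f.gnsVec - f.gnsRep a z ∈ Mᗮ := by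
    rw [hz, gnsRep_starProjection_gnsVec]
    exact M.sub_starProjection_mem_orthogonal _
  have h1 : ⟪z, f.gnsRep a f.gnsVec - f.gnsRep a z⟫_ℂ = 0 :=
    (Submodule.mem_orthogonal _ _).mp hs _ hzM
  have h2 : ⟪f.gnsVec - z, f.gnsRep a z⟫_ℂ = 0 :=
    (Submodule.mem_orthogonal' _ _).mp (M.sub_starProjection_mem_orthogonal _) _
      (gnsRep_mem_multivaluedPart f g a hzM)
  change f.toLin a - ⟪f.gnsVec - z, f.gnsRep a (f.gnsVec - z)⟫_ℂ = ⟪z, f.gnsRep a z⟫_ℂ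
  rw [← inner_gnsVec]
  simp only [map_sub, inner_sub_left, inner_sub_right] at h1 h2 ⊢
  linear_combination h1 + h2

/-- `[a]_f` is approximated, up to its absolutely continuous component, by `g`-null sequences. -/
lemma exists_tendsto_singClass (f g : RepFunctional A) (a : A) : ∃ b : ℕ → A,
    Tendsto (fun n => f.gnsClass (b n)) atTop (𝓝 (singClass f g a)) ∧
    Tendsto (fun n => ‖g.gnsClass (b n)‖) atTop (𝓝 0) :=
  (mem_multivaluedPart_iff f g _).mp (Submodule.starProjection_apply_mem _ _)

/-! ### Absolute continuity, maximality and singularity -/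

lemma isAbsolutelyContinuous_acPart (f g : RepFunctional A) :
    IsAbsolutelyContinuous (acPart f g).toLin g.toLin := by
  rw [isAbsolutelyContinuous_iff]
  intro a hg hc
  set M := multivaluedPart f g with hM
  -- Only the components orthogonal to M are known to be Cauchy. Their limit η is orthogonal to M;
  -- since [a_n]_g → 0 and removing M-components stays in the closed diagonal, η also lies in M.
  have hc' : CauchySeq fun n => f.gnsClass (a n) - singClass f g (a n) := by
    rw [cauchySeq_iff_tendsto_dist_atTop_0] at hc ⊢
    convert hc using 2 with p
    rw [dist_eq_norm, dist_eq_norm, ← map_sub, norm_acPart]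
    simp only [singClass, map_sub]
    congr 1
    abel
  obtain ⟨η, hη⟩ := cauchySeq_tendsto_of_complete hc'
  have h1 : η ∈ Mᗮ := M.isClosed_orthogonal.mem_of_tendsto hη
    (Eventually.of_forall fun n => M.sub_starProjection_mem_orthogonal _)
  have h2 : η ∈ M := by
    rw [mem_multivaluedPart]
    have hmem (n : ℕ) : diagonalVec f g (a n) - inlCLM f g (singClass f g (a n)) ∈
        (diagonal f g).topologicalClosure :=
      sub_mem ((diagonal f g).le_topologicalClosure ((mem_diagonal_iff f g _).mpr ⟨a n, rfl⟩))
        ((mem_multivaluedPart f g _).mp (Submodule.starProjection_apply_mem _ _))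
    refine (diagonal f g).isClosed_topologicalClosure.mem_of_tendsto (b := atTop) ?_
      (Eventually.of_forall hmem)
    have h := ((WithLp.prodContinuousLinearEquiv 2 ℂ f.GNS g.GNS).symm.continuous.tendsto _).comp
      (hη.prodMk_nhds (tendsto_zero_iff_norm_tendsto_zero.mpr hg))
    refine h.congr fun n => ?_
    change WithLp.toLp 2 (_, _) = WithLp.toLp 2 (f.gnsClass (a n), g.gnsClass (a n)) -
      WithLp.toLp 2 (singClass f g (a n), 0)
    rw [← WithLp.toLp_sub, Prod.mk_sub_mk, sub_zero]
  have h0 : η = 0 := inner_self_eq_zero.mp ((Submodule.mem_orthogonal _ _).mp h1 _ h2)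
  simp only [norm_acPart]
  rw [h0] at hη
  exact tendsto_zero_iff_norm_tendsto_zero.mp hη

/-- Take a g-null sequence b_n with [b_n]_f tending to the M-component of [a]_f. It is Cauchy for h,
so h ≪ g makes it h-null, and subtracting it from a does not change the h-seminorm in the limit. -/
lemma le_acPart (f g h : RepFunctional A) (hf : h ≤ f)
    (hg : IsAbsolutelyContinuous h.toLin g.toLin) : h ≤ acPart f g := by
  rw [le_iff_norm] at hf ⊢
  rw [isAbsolutelyContinuous_iff] at hg
  intro a
  obtain ⟨b, hb1, hb2⟩ := exists_tendsto_singClass f g a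
  have hb3 := hg b hb2 <| by
    have hc := hb1.cauchySeq
    rw [cauchySeq_iff_tendsto_dist_atTop_0] at hc ⊢
    refine squeeze_zero (fun _ => dist_nonneg) (fun p => ?_) hc
    rw [dist_eq_norm, dist_eq_norm, ← map_sub, ← map_sub]
    exact hf _
  rw [norm_acPart]
  have hlim := ((tendsto_const_nhds (x := f.gnsClass a)).sub hb1).norm.add hb3
  rw [add_zero] at hlim
  refine ge_of_tendsto' hlim fun n => ?_
  calc ‖h.gnsClass a‖ = ‖h.gnsClass (a - b n) + h.gnsClass (b n)‖ := by simp
    _ ≤ ‖h.gnsClass (a - b n)‖ + ‖h.gnsClass (b n)‖ := norm_add_le _ _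
    _ ≤ _ := by
      rw [← map_sub]
      gcongr
      exact hf _

lemma eq_zero_of_gnsClass_eq_zero (h : RepFunctional A) (h0 : ∀ a, h.gnsClass a = 0) :
    h.toLin = 0 := by
  ext a
  rw [← inner_gnsVec]
  change ⟪_, h.gnsClass a⟫_ℂ = _
  simp [h0]

lemma isSingular_singPart (f g : RepFunctional A) :
    IsSingular (singPart f g).toLin g.toLin := by
  intro k hk hkf hkg
  let h : RepFunctional A := ⟨k, hk⟩
  have hf := (le_iff_norm h (singPart f g)).mp hkf
  have hg := (le_iff_norm h g).mp hkg
  refine eq_zero_of_gnsClass_eq_zero h fun a => ?_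
  obtain ⟨b, hb1, hb2⟩ := exists_tendsto_singClass f g a
  have hP : Tendsto (fun n => ‖singClass f g (a - b n)‖) atTop (𝓝 0) := by
    have h1 := (((multivaluedPart f g).starProjection.continuous.tendsto _).comp
      ((tendsto_const_nhds (x := f.gnsClass a)).sub hb1)).norm
    rw [map_sub, Submodule.starProjection_eq_self_iff.mpr
      (Submodule.starProjection_apply_mem _ _), sub_self, norm_zero] at h1
    simpa [Function.comp_def, singClass] using h1
  have hlim := hP.add hb2
  rw [add_zero] at hlim
  rw [← norm_le_zero_iff]
  refine ge_of_tendsto' hlim fun n => ?_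
  calc ‖h.gnsClass a‖ = ‖h.gnsClass (a - b n) + h.gnsClass (b n)‖ := by simp
    _ ≤ ‖h.gnsClass (a - b n)‖ + ‖h.gnsClass (b n)‖ := norm_add_le _ _
    _ ≤ _ := by
      rw [← norm_singPart]
      exact add_le_add (hf _) (hg _)

/-! ### The supremum of the parallel sums -/

lemma parallelSum_nsmul_le_acPart (f g : RepFunctional A) (n : ℕ) :
    parallelSum f (n • g) ≤ acPart f g := by
  rw [le_iff_norm_sq]
  intro a
  obtain ⟨b, hb1, hb2⟩ := exists_tendsto_singClass f g a
  have hlim := (((tendsto_const_nhds (x := f.gnsClass a)).sub hb1).norm.pow 2).add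
    ((hb2.pow 2).const_mul (n : ℝ))
  rw [norm_acPart]
  simp only [ne_eq, OfNat.ofNat_ne_zero, not_false_eq_true, zero_pow, mul_zero, add_zero] at hlim
  refine ge_of_tendsto' hlim fun k => ?_
  rw [← norm_gnsClass_nsmul_sq]
  exact norm_parallelSum_sq_le f (n • g) a (b k)

/-- Uniform convexity: near-minimisers of a quadratic functional are close once their midpoint
cannot do much better. -/
lemma norm_sub_sq_le_of_midpoint {H K : Type*} [NormedAddCommGroup H] [InnerProductSpace ℂ H]
    [NormedAddCommGroup K] [InnerProductSpace ℂ K] (x y : H) (u v : K) (c s t : ℝ) (hc : 0 ≤ c)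
    (hx : ‖x‖ ^ 2 + c * ‖u‖ ^ 2 ≤ t) (hy : ‖y‖ ^ 2 + c * ‖v‖ ^ 2 ≤ t)
    (hm : s ≤ ‖(1 / 2 : ℂ) • (x + y)‖ ^ 2 + c * ‖(1 / 2 : ℂ) • (u + v)‖ ^ 2) :
    ‖x - y‖ ^ 2 ≤ 4 * (t - s) := by
  have h1 := parallelogram_law_with_norm ℂ x y
  have h2 := parallelogram_law_with_norm ℂ u v
  have h3 : 0 ≤ c * ‖u - v‖ ^ 2 := by positivity
  rw [norm_smul, norm_smul, mul_pow, mul_pow] at hm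
  norm_num at hm
  have h4 : c * ‖u - v‖ ^ 2 = 2 * (c * ‖u‖ ^ 2 + c * ‖v‖ ^ 2) - c * ‖u + v‖ ^ 2 := by
    linear_combination c * h2
  nlinarith

lemma acPart_le_of_forall_parallelSum_le (f g h : RepFunctional A)
    (hh : ∀ n : ℕ, parallelSum f (n • g) ≤ h) : acPart f g ≤ h := by
  rw [le_iff_norm_sq]
  intro a
  let S (n : ℕ) : ℝ := ‖(parallelSum f (n • g)).gnsClass a‖ ^ 2
  have hS : BddAbove (Set.range S) :=
    ⟨‖h.gnsClass a‖ ^ 2, by rintro _ ⟨n, rfl⟩; exact (le_iff_norm_sq _ _).mp (hh n) a⟩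
  set s := ⨆ n, S n with hs
  have hsn (n : ℕ) : S n ≤ s := le_ciSup hS n
  have hs0 : 0 ≤ s := (sq_nonneg _).trans (hsn 0)
  have hsh : s ≤ ‖h.gnsClass a‖ ^ 2 := ciSup_le fun n => (le_iff_norm_sq _ _).mp (hh n) a
  have hle (n : ℕ) (b : A) :
      S n ≤ ‖f.gnsClass a - f.gnsClass b‖ ^ 2 + n * ‖g.gnsClass b‖ ^ 2 := by
    rw [← norm_gnsClass_nsmul_sq]
    exact norm_parallelSum_sq_le f (n • g) a b
  -- Near-minimisers of the n-th problem, with error 1/(n+1) measured from the supremum s.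
  have hex (n : ℕ) : ∃ b, ‖f.gnsClass a - f.gnsClass b‖ ^ 2 + n * ‖g.gnsClass b‖ ^ 2 <
      s + 1 / ((n : ℝ) + 1) := by
    obtain ⟨b, hb⟩ := exists_lt_norm_parallelSum_sq_add f (n • g) a
      (Nat.one_div_pos_of_nat (α := ℝ) (n := n))
    rw [norm_gnsClass_nsmul_sq] at hb
    exact ⟨b, hb.trans_le (by gcongr; exact hsn n)⟩
  choose b hb using hex
  have hf : CauchySeq fun n => f.gnsClass (b n) := by
    refine Metric.cauchySeq_iff.mpr fun ε hε => ?_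
    -- The midpoint estimate gives 4 · 2δ = ε²/2 < ε².
    set δ := ε ^ 2 / 16 with hδ
    have hδ0 : 0 < δ := by positivity
    obtain ⟨N₁, hN₁⟩ := exists_lt_of_lt_ciSup (show s - δ < ⨆ n, S n by linarith)
    obtain ⟨N₂, hN₂⟩ := exists_nat_one_div_lt hδ0
    -- All later near-minimisers are compared in the single problem with weight N₁: lowering the
    -- weight from n only lowers the value.
    have hbd (n : ℕ) (hn : max N₁ N₂ ≤ n) :
        ‖f.gnsClass a - f.gnsClass (b n)‖ ^ 2 + N₁ * ‖g.gnsClass (b n)‖ ^ 2 ≤ s + δ := by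
      have h1 : (N₁ : ℝ) ≤ n := by exact_mod_cast (le_max_left _ _).trans hn
      have h2 : (1 : ℝ) / (n + 1) ≤ 1 / (N₂ + 1) :=
        Nat.one_div_le_one_div ((le_max_right _ _).trans hn)
      have h3 : (N₁ : ℝ) * ‖g.gnsClass (b n)‖ ^ 2 ≤ n * ‖g.gnsClass (b n)‖ ^ 2 := by gcongr
      have := hb n
      linarith
    refine ⟨max N₁ N₂, fun m hm n hn => ?_⟩
    have key := norm_sub_sq_le_of_midpoint (f.gnsClass a - f.gnsClass (b m))
      (f.gnsClass a - f.gnsClass (b n)) (g.gnsClass (b m)) (g.gnsClass (b n)) N₁ (s - δ) (s + δ)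
      (Nat.cast_nonneg _) (hbd m hm) (hbd n hn) (by
        refine hN₁.le.trans ((hle N₁ ((1 / 2 : ℂ) • (b m + b n))).trans_eq ?_)
        simp only [map_smul, map_add]
        congr 3
        module)
    rw [sub_sub_sub_cancel_left, norm_sub_rev, ← dist_eq_norm] at key
    refine lt_of_pow_lt_pow_left₀ 2 hε.le (key.trans_lt ?_)
    rw [hδ]
    nlinarith [sq_pos_of_pos hε]
  -- The penalty n‖[b_n]_g‖² stays below s + 1; divide by n.
  have hg : Tendsto (fun n => ‖g.gnsClass (b n)‖) atTop (𝓝 0) := by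
    have h1 : Tendsto (fun n => ‖g.gnsClass (b n)‖ ^ 2) atTop (𝓝 0) := by
      refine squeeze_zero' (Eventually.of_forall fun _ => sq_nonneg _) ?_
        (tendsto_const_div_atTop_nhds_zero_nat (s + 1))
      filter_upwards [eventually_gt_atTop 0] with n hn
      have hn' : (0 : ℝ) < n := by exact_mod_cast hn
      rw [le_div_iff₀' hn']
      have h2 : (1 : ℝ) / (n + 1) ≤ 1 := by
        rw [div_le_one (by positivity)]
        linarith
      have := hb n
      have := sq_nonneg ‖f.gnsClass a - f.gnsClass (b n)‖
      linarith
    simpa using h1.sqrt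
  obtain ⟨ξ, hξ⟩ := cauchySeq_tendsto_of_complete hf
  have hξM : ξ ∈ multivaluedPart f g := (mem_multivaluedPart_iff f g ξ).mpr ⟨b, hξ, hg⟩
  have hξs : ‖f.gnsClass a - ξ‖ ^ 2 ≤ s := by
    have hlim := (tendsto_const_nhds (x := s)).add (tendsto_one_div_add_atTop_nhds_zero_nat (𝕜 := ℝ))
    rw [add_zero] at hlim
    refine le_of_tendsto_of_tendsto' (((tendsto_const_nhds (x := f.gnsClass a)).sub hξ).norm.pow 2)
      hlim fun n => ?_
    have : 0 ≤ (n : ℝ) * ‖g.gnsClass (b n)‖ ^ 2 := by positivity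
    exact (le_add_of_nonneg_right this).trans (hb n).le
  refine le_trans ?_ (hξs.trans hsh)
  rw [norm_acPart]
  gcongr
  -- The projection realises the distance to M, and ξ is one competitor.
  rw [singClass, Submodule.starProjection_minimal]
  exact ciInf_le ⟨0, by rintro _ ⟨_, rfl⟩; exact norm_nonneg _⟩
    (⟨ξ, hξM⟩ : multivaluedPart f g)

lemma isLUB_acPart (f g : RepFunctional A) :
    IsLUB (Set.range fun n : ℕ => parallelSum f (n • g)) (acPart f g) :=
  ⟨by rintro _ ⟨n, rfl⟩; exact parallelSum_nsmul_le_acPart f g n,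
    fun h hh => acPart_le_of_forall_parallelSum_le f g h fun n => hh ⟨n, rfl⟩⟩

lemma isLebesgueDecomposition_acPart (f g : RepFunctional A) :
    IsLebesgueDecomposition g.toLin f.toLin (acPart f g).toLin
      (f.toLin - (acPart f g).toLin) := by
  refine ⟨by abel, (acPart f g).representable, ?_, isAbsolutelyContinuous_acPart f g, ?_⟩
  · rw [toLin_sub_acPart]
    exact (singPart f g).representable
  · rw [toLin_sub_acPart]
    exact isSingular_singPart f g

end

end RepFunctional

theorem theoremT {A : Type u} [NonUnitalRing A] [StarRing A] [Module ℂ A] [StarModule ℂ A]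
    [IsScalarTower ℂ A A] [SMulCommClass ℂ A A] (f g : RepFunctional A) :
    ∃ r : RepFunctional A,
      IsLUB (Set.range fun n : ℕ => RepFunctional.parallelSum f (n • g)) r ∧
      IsLebesgueDecomposition g.toLin f.toLin r.toLin (f.toLin - r.toLin) ∧
      ∀ h : RepFunctional A, h ≤ f → IsAbsolutelyContinuous h.toLin g.toLin → h ≤ r := by
  exact ⟨RepFunctional.acPart f g, RepFunctional.isLUB_acPart f g,
    RepFunctional.isLebesgueDecomposition_acPart f g, fun h => RepFunctional.le_acPart f g h⟩
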